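/- Let $R$ be a subring of an associative unital ring $A$, and let $A=\sigma(R)\langle x_1,\dots,x_n\rangle$ be a skew PBW extension of $R$. That is: $x_1,\dots,x_n\in A$; the monomials $x^t=x_1^{t_1}\cdots x_n^{t_n}$ ($t\in\mathbb N^n$) form a basis of $A$ as a left $R$-module; for all $i$ and all $r\in R\setminus\{0\}$ there is $c_{i,r}\in R\setminus\{0\}$ with $x_ir-c_{i,r}x_i\in R$; and for all $i,j$ there is $c_{j,i}\in R\setminus\{0\}$ with $x_jx_i-c_{j,i}x_ix_j\in R+Rx_1+\dots+Rx_n$. For each $i$ let $\sigma_i$ be the endomorphism of $R$ for which $x_ir-\sigma_i(r)x_i\in R$ for all $r\in R$. Let $N$ be the subgroup of the unit group $R^*$ generated by the derived subgroup $[R^*,R^*]$ and all elements $z^{-1}\sigma_i(z)$ with $z\in R^*$ and $1\le i\le n$. Assume that $A$ is general: the $c_{i,j}$ ($1\le i,j\le n$) can be taken to be units of $R$, and the images of the $c_{i,j}$ with $1\le i<j\le n$ are multiplicatively independent (over $\mathbb Z$) in the abelian group $R^*/N$. Let $\operatorname{End}(A)$ be the monoid of ring endomorphisms of $A$ that fix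 every element of $R$, and let $\operatorname{Aut}(A)$ be its group of invertible elements. Filter $A$ by $F_0=R$ and $F_m=\{f\in A:\deg f\le m\}$ for $m\ge 1$, where $\deg f$ is the largest total degree $t_1+\dots+t_n$ of a monomial $x^t$ occurring in $f$. Let $\lambda\in\operatorname{End}(A)$ be filtered, i.e. $\lambda(F_m)\subseteq F_m$ for all $m\ge 0$. Suppose that for every $i$ with $\lambda(x_i)\ne 0$ one has $\lambda(x_i)\notin F_0$ and the leading coefficient of $\lambda(x_i)$, with respect to the lexicographical order on exponents, is a unit of $R$; and suppose that $\lambda(x_i)\neq 0$ for at least three distinct indices $i$. If $\lambda(x_i)\ne 0$ for every $i=1,\dots,n$, then $\lambda\in\operatorname{Aut}(A)$. In particular, if $\lambda$ is injective, then $\lambda\in\operatorname{Aut}(A)$. -/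

import Mathlib

namespace SkewPBW

variable {A : Type*} [Ring A]

/-- The ordered monomial `x₁ ^ t₁ * ⋯ * xₙ ^ tₙ`. -/
def mon {n : ℕ} (x : Fin n → A) (t : Fin n → ℕ) : A :=
  (List.ofFn fun i => x i ^ t i).prod

/-- `A` is a skew PBW extension of its subring `R` in the variables `x₁, …, xₙ`.
`A` is a left `R`-module by multiplication, `r • a = r * a`. -/
structure IsSkewPBW (R : Subring A) {n : ℕ} (x : Fin n → A) : Prop where
  /-- the monomials are linearly independent over `R` on the left … -/
  linearIndependent : LinearIndependent R (mon x)
  /-- … and generate `A` as a left `R`-module -/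
  span_eq_top : Submodule.span R (Set.range (mon x)) = ⊤
  /-- `x_i r - c_{i,r} x_i ∈ R` with `c_{i,r} ≠ 0`, for `r ≠ 0` -/
  comm_coeff : ∀ (i : Fin n) (r : R), r ≠ 0 →
    ∃ c : R, c ≠ 0 ∧ x i * (r : A) - (c : A) * x i ∈ R
  /-- `x_j x_i - c_{j,i} x_i x_j ∈ R + R x_1 + ⋯ + R x_n` with `c_{j,i} ≠ 0` -/
  comm_var : ∀ i j : Fin n, ∃ c : R, c ≠ 0 ∧
    x j * x i - (c : A) * (x i * x j) ∈ Submodule.span R (insert (1 : A) (Set.range x))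

namespace IsSkewPBW

variable {R : Subring A} {n : ℕ} {x : Fin n → A}

/-- The monomials as a basis of the left `R`-module `A`. -/
noncomputable def basis (h : IsSkewPBW R x) : Module.Basis (Fin n → ℕ) R A :=
  Module.Basis.mk h.linearIndependent h.span_eq_top.ge

/-- The coefficient of `x ^ t` in `f`. -/
noncomputable def coeff (h : IsSkewPBW R x) (f : A) (t : Fin n → ℕ) : R :=
  h.basis.repr f t

/-- The finite set of exponents of the terms of `f`. -/
noncomputable def support (h : IsSkewPBW R x) (f : A) : Finset (Fin n → ℕ) :=
  (h.basis.repr f).support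

/-- The degree: the largest `t₁ + ⋯ + tₙ` over the terms of `f` (and `0` if `f = 0`). -/
noncomputable def deg (h : IsSkewPBW R x) (f : A) : ℕ :=
  h.support f |>.sup fun t => ∑ i, t i

/-- The standard filtration: `F₀ = R` and `Fₘ = {f | deg f ≤ m}` for `m ≥ 1`. -/
noncomputable def filt (h : IsSkewPBW R x) : ℕ → Set A
  | 0 => (R : Set A)
  | m + 1 => {f | h.deg f ≤ m + 1}

/-- The leading coefficient of `f`: the coefficient at the largest exponent of `f` for the
lexicographical order of `ℕⁿ` (and `0` if `f = 0`). -/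
noncomputable def leadCoeff (h : IsSkewPBW R x) (f : A) : R :=
  if hf : ((h.support f).image toLex).Nonempty then
    h.coeff f (ofLex (((h.support f).image toLex).max' hf))
  else 0

theorem mon_zero : mon x 0 = 1 := by
  unfold mon
  apply List.prod_eq_one
  intro a ha
  rw [List.mem_ofFn] at ha
  obtain ⟨i, rfl⟩ := ha
  simp

theorem mon_single (i : Fin n) : mon x (Pi.single i 1) = x i := by
  unfold mon
  induction n with
  | zero => exact i.elim0
  | succ n ih =>
    rw [List.ofFn_succ, List.prod_cons]
    refine Fin.cases ?_ (fun j => ?_) i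
    · have h1 : (List.ofFn fun k : Fin n =>
          x k.succ ^ (Pi.single (0 : Fin (n + 1)) 1 : Fin (n + 1) → ℕ) k.succ).prod = 1 := by
        apply List.prod_eq_one
        intro a ha
        rw [List.mem_ofFn] at ha
        obtain ⟨k, rfl⟩ := ha
        simp
      rw [h1]
      simp
    · have h0 : (Pi.single j.succ 1 : Fin (n + 1) → ℕ) 0 = 0 :=
        Pi.single_eq_of_ne (Fin.succ_ne_zero j).symm _
      have hs : ∀ k : Fin n, (Pi.single j.succ 1 : Fin (n + 1) → ℕ) k.succ
          = (Pi.single j 1 : Fin n → ℕ) k := by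
        intro k
        simp [Pi.single_apply]
      rw [h0]
      simp only [hs, pow_zero, one_mul]
      exact ih (x := fun k => x k.succ) j

theorem coeff_linear (h : IsSkewPBW R x) (i : Fin n) (a b : R) :
    h.coeff ((a : A) * x i + (b : A)) (Pi.single i 1) = a := by
  have h1 : (a : A) * x i + (b : A)
      = a • h.basis (Pi.single i 1) + b • h.basis 0 := by
    simp [basis, mon_zero, mon_single, Subring.smul_def]
  have h2 : (0 : Fin n → ℕ) ≠ Pi.single i 1 := by
    intro e
    have := congrFun e i
    simp at this
  unfold coeff
  rw [h1, map_add, map_smul, map_smul, Module.Basis.repr_self, Module.Basis.repr_self]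
  simp [Finsupp.single_eq_of_ne h2.symm]

theorem exists_comm (h : IsSkewPBW R x) (i : Fin n) (r : R) :
    ∃ c d : R, x i * (r : A) = (c : A) * x i + (d : A) := by
  by_cases hr : r = 0
  · exact ⟨0, 0, by simp [hr]⟩
  · obtain ⟨c, -, hc⟩ := h.comm_coeff i r hr
    exact ⟨c, ⟨_, hc⟩, by simp⟩

/-- The ring endomorphism `σ_i` of `R` with `x_i r = σ_i(r) x_i + δ_i(r)`: `σ_i(r)` is the
coefficient of `x_i` in `x_i r`. -/
noncomputable def sigma (h : IsSkewPBW R x) (i : Fin n) : R →+* R where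
  toFun r := h.coeff (x i * (r : A)) (Pi.single i 1)
  map_one' := by
    have := h.coeff_linear i 1 0
    simpa using this
  map_zero' := by simp [coeff]
  map_add' r s := by simp [coeff, mul_add]
  map_mul' r s := by
    obtain ⟨c, d, hr⟩ := h.exists_comm i r
    obtain ⟨c', d', hs⟩ := h.exists_comm i s
    have e : x i * ((r * s : R) : A) = ((c * c' : R) : A) * x i + ((c * d' + d * s : R) : A) := by
      push_cast
      rw [← mul_assoc, hr, add_mul, mul_assoc, hs]
      noncomm_ring
    rw [e, hr, hs, coeff_linear, coeff_linear, coeff_linear]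

/-- The defining property of `σ_i`; the element of `R` on the right is `δ_i(r)`. -/
theorem sigma_spec (h : IsSkewPBW R x) (i : Fin n) (r : R) :
    ∃ d : R, x i * (r : A) = (h.sigma i r : A) * x i + (d : A) := by
  obtain ⟨c, d, hr⟩ := h.exists_comm i r
  refine ⟨d, ?_⟩
  have : h.sigma i r = c := by
    change h.coeff (x i * (r : A)) (Pi.single i 1) = c
    rw [hr, coeff_linear]
  rw [this, hr]

/-- The subgroup `N` of the unit group of `R` generated by the derived subgroup and all
`z⁻¹ σ_i(z)`, `z` a unit of `R`. -/
noncomputable def N (h : IsSkewPBW R x) : Subgroup Rˣ :=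
  commutator Rˣ ⊔
    Subgroup.closure {u | ∃ (i : Fin n) (z : Rˣ),
      u = z⁻¹ * Units.map (h.sigma i : R →* R) z}

theorem commutator_le_N (h : IsSkewPBW R x) : commutator Rˣ ≤ h.N :=
  le_sup_left

instance normal_N (h : IsSkewPBW R x) : h.N.Normal :=
  Subgroup.Normal.of_commutator_le (G := Rˣ) h.commutator_le_N

/-- `Rˣ / N` is commutative. -/
noncomputable instance commGroupQuotient (h : IsSkewPBW R x) : CommGroup (Rˣ ⧸ h.N) :=
  { QuotientGroup.Quotient.group h.N with
    mul_comm :=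
      (Subgroup.Normal.quotient_commutative_iff_commutator_le.mpr
        h.commutator_le_N).is_comm.comm }

/-- `A` is general: the `c_{i,j}` are units of `R`, and the images of the `c_{i,j}` with `i < j`
in the abelian group `Rˣ / N` are (multiplicatively, that is `ℤ`-linearly) independent. -/
def IsGeneral (h : IsSkewPBW R x) : Prop :=
  ∃ c : Fin n → Fin n → Rˣ,
    (∀ i j, x i * x j - ((c i j : R) : A) * (x j * x i) ∈
      Submodule.span R (insert (1 : A) (Set.range x))) ∧
    LinearIndependent ℤ (fun p : {p : Fin n × Fin n // p.1 < p.2} =>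
      Additive.ofMul (QuotientGroup.mk (c p.1.1 p.1.2) : Rˣ ⧸ h.N))

end IsSkewPBW

/-- `End(A)`: the monoid (under composition) of the ring endomorphisms of `A` that fix `R`
elementwise. Its invertible elements form `Aut(A)`. -/
def relEnd (R : Subring A) : Submonoid (A →+* A) where
  carrier := {f | ∀ r ∈ R, f r = r}
  one_mem' := fun _ _ => rfl
  mul_mem' := by
    intro f g hf hg r hr
    change f (g r) = r
    rw [hg r hr, hf r hr]

end SkewPBW

/-! ### Ordered monomials and exponents of small degree -/

namespace SkewPBW

variable {A : Type*} [Ring A]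

/-! Being filtered, `lam` sends each x_i to an affine element, and its lexicographic leading term is
u_i x_{π(i)} with u_i a unit and no earlier variable present. Apply `lam` to x_i x_j ≡ c_{ij} x_j
x_i (mod `affine`) and read off the coefficient of x_{π(i)} x_{π(j)}. Modulo N the twists σ_k
disappear and the u_i cancel. If π(i) = π(j) with i < j, then c_{ij} becomes trivial, against
independence; otherwise c_{ij} = c_{π(i)π(j)} in the quotient. Since c_{ij} c_{ji} = 1 there for i ≠
j, independence makes (i, j) ↦ c_{ij} injective off the diagonal, so π is the identity
(`lead_eq_self`).

Thus `lam` is triangular on the variables with units on the diagonal. To pass to monomials, the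
variables get decreasing weights, each smaller than any sum of two: the affine errors in the
commutation relations then have smaller weight, and so do the later variables in lam(x_i). Hence
lam(x^t) is a unit times x^t plus terms of smaller weight (`map_mon_of_triangular`), which forces
bijectivity (`bijective_of_map_mon`). -/

theorem mul_mon_of_forall_lt {n : ℕ} (x : Fin n → A) (i : Fin n) (t : Fin n → ℕ)
    (ht : ∀ j < i, t j = 0) : x i * mon x t = mon x (t + Pi.single i 1) := by
  induction n with
  | zero => exact i.elim0
  | succ n ih =>
    have hcons : ∀ s : Fin (n + 1) → ℕ,
        mon x s = x 0 ^ s 0 * mon (fun k : Fin n => x k.succ) (fun k => s k.succ) := by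
      intro s
      simp [mon, List.ofFn_succ]
    rw [hcons t, hcons (t + _)]
    cases i using Fin.cases with
    | zero => simp [← mul_assoc, pow_succ']
    | succ j =>
      have h0 : t 0 = 0 := ht 0 (Fin.succ_pos j)
      have hs : (fun k : Fin n => (t + Pi.single j.succ 1 : Fin (n + 1) → ℕ) k.succ)
          = (fun k => t k.succ) + Pi.single j 1 := by
        funext k
        simp [Pi.single_apply]
      rw [hs, ← ih (fun k => x k.succ) j (fun k => t k.succ)
        (fun k hk => ht k.succ (Fin.succ_lt_succ_iff.mpr hk))]
      simp [h0]

/-- Every nonzero exponent has a least index in its support, which can be split off. -/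
theorem exists_eq_add_single {n : ℕ} {t : Fin n → ℕ} (ht : t ≠ 0) :
    ∃ (i : Fin n) (s : Fin n → ℕ), t = s + Pi.single i 1 ∧ ∀ j < i, s j = 0 := by
  have hne : (Finset.univ.filter fun i => t i ≠ 0).Nonempty := by
    obtain ⟨i, hi⟩ := Function.ne_iff.mp ht
    exact ⟨i, by simpa using hi⟩
  set i := (Finset.univ.filter fun i => t i ≠ 0).min' hne with hi
  have hti : t i ≠ 0 := by simpa using Finset.min'_mem _ hne
  have hmin : ∀ j < i, t j = 0 := by
    intro j hj
    by_contra hc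
    exact absurd (Finset.min'_le _ j (by simpa using hc)) (not_le.mpr hj)
  refine ⟨i, t - Pi.single i 1, ?_, fun j hj => by simp [hmin j hj]⟩
  funext j
  by_cases hji : j = i
  · subst hji
    simp
    omega
  · simp [hji]

theorem mon_single_add_single {n : ℕ} (x : Fin n → A) {k l : Fin n} (hkl : k ≤ l) :
    mon x (Pi.single k 1 + Pi.single l 1) = x k * x l := by
  rw [add_comm, ← mul_mon_of_forall_lt x k (Pi.single l 1), IsSkewPBW.mon_single]
  intro j hj
  exact Pi.single_eq_of_ne (hj.trans_le hkl).ne _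

theorem sum_single_add_single {n : ℕ} (k l : Fin n) :
    ∑ i, (Pi.single k 1 + Pi.single l 1 : Fin n → ℕ) i = 2 := by
  simp [Finset.sum_add_distrib]

theorem single_add_single_eq {n : ℕ} {k l p q : Fin n}
    (h : (Pi.single p 1 + Pi.single q 1 : Fin n → ℕ) = Pi.single k 1 + Pi.single l 1) :
    (p = k ∧ q = l) ∨ (p = l ∧ q = k) := by
  have hk := congrFun h k
  have hl := congrFun h l
  have hp := congrFun h p
  have hq := congrFun h q
  simp only [Pi.add_apply, Pi.single_apply] at hk hl hp hq
  grind

/-- An exponent of total degree at most one is zero or a coordinate vector. -/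
theorem eq_zero_or_eq_single {n : ℕ} {t : Fin n → ℕ} (ht : ∑ i, t i ≤ 1) :
    t = 0 ∨ ∃ i, t = Pi.single i 1 := by
  by_cases h0 : t = 0
  · exact Or.inl h0
  obtain ⟨i, s, rfl, -⟩ := exists_eq_add_single h0
  right
  refine ⟨i, ?_⟩
  have hs : ∑ i, s i = 0 := by
    simp [Finset.sum_add_distrib] at ht
    simpa using ht
  have : s = 0 := by
    funext j
    exact (Finset.sum_eq_zero_iff.mp hs) j (Finset.mem_univ j)
  simp [this]

/-! ### Affine elements and the degree-two coefficients of their products -/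

namespace IsSkewPBW

variable {R : Subring A} {n : ℕ} {x : Fin n → A}

/-- Taking the coefficient of `x ^ t` as a linear functional. -/
noncomputable def coeffL (h : IsSkewPBW R x) (t : Fin n → ℕ) : A →ₗ[R] R :=
  Finsupp.lapply t ∘ₗ h.basis.repr.toLinearMap

theorem coeffL_apply (h : IsSkewPBW R x) (t : Fin n → ℕ) (f : A) :
    h.coeffL t f = h.coeff f t := rfl

theorem basis_apply (h : IsSkewPBW R x) (t : Fin n → ℕ) : h.basis t = mon x t := by
  simp [basis]

theorem coeffL_mon (h : IsSkewPBW R x) (s t : Fin n → ℕ) :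
    h.coeffL t (mon x s) = if s = t then 1 else 0 := by
  rw [← h.basis_apply, coeffL_apply, coeff, Module.Basis.repr_self, Finsupp.single_apply]

theorem coeffL_eq_zero_of_mem_span (h : IsSkewPBW R x) {f : A} {S : Set (Fin n → ℕ)}
    (hf : f ∈ Submodule.span R (mon x '' S)) {t : Fin n → ℕ} (ht : t ∉ S) :
    h.coeffL t f = 0 := by
  have : Submodule.span R (mon x '' S) ≤ LinearMap.ker (h.coeffL t) := by
    rw [Submodule.span_le]
    rintro _ ⟨s, hs, rfl⟩
    have hst : s ≠ t := fun e => ht (e ▸ hs)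
    simp [coeffL_mon, hst]
  exact this hf

theorem sum_coeff (h : IsSkewPBW R x) (f : A) :
    f = ∑ t ∈ h.support f, h.coeff f t • mon x t := by
  conv_lhs => rw [← h.basis.linearCombination_repr f]
  simp only [Finsupp.linearCombination_apply, Finsupp.sum, support, coeff, basis_apply]

theorem mul_smul_eq (h : IsSkewPBW R x) (i : Fin n) (r : R) :
    ∃ d : R, ∀ f : A, x i * (r • f) = h.sigma i r • (x i * f) + d • f := by
  obtain ⟨d, hd⟩ := h.sigma_spec i r
  refine ⟨d, fun f => ?_⟩
  simp only [Subring.smul_def, smul_eq_mul]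
  rw [← mul_assoc, hd, add_mul, mul_assoc]

variable (R x) in
/-- The `R`-span of `1, x₁, …, xₙ`. -/
def affine : Submodule R A := Submodule.span R (insert (1 : A) (Set.range x))

theorem one_mem_affine : (1 : A) ∈ affine R x :=
  Submodule.subset_span (Set.mem_insert _ _)

theorem var_mem_affine (i : Fin n) : x i ∈ affine R x :=
  Submodule.subset_span (Set.mem_insert_of_mem _ ⟨i, rfl⟩)

theorem affine_le {M : Submodule R A} (h1 : (1 : A) ∈ M) (hx : ∀ i, x i ∈ M) :
    affine R x ≤ M := by
  rw [affine, Submodule.span_le]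
  rintro _ (rfl | ⟨i, rfl⟩)
  exacts [h1, hx i]

/-- Degree-two coefficients do not see the unspecified affine remainders, so congruences modulo
`affine` become equations in R. -/
theorem coeffL_affine (h : IsSkewPBW R x) {f : A} (hf : f ∈ affine R x) (k l : Fin n) :
    h.coeffL (Pi.single k 1 + Pi.single l 1) f = 0 := by
  refine h.coeffL_eq_zero_of_mem_span (S := {t | ∑ i, t i ≤ 1}) ?_ ?_
  · refine affine_le ?_ (fun i => ?_) hf
    · exact Submodule.subset_span ⟨0, by simp, mon_zero⟩
    · exact Submodule.subset_span ⟨Pi.single i 1, by simp, mon_single i⟩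
  · rw [Set.mem_ofPred_eq, sum_single_add_single]
    simp

theorem mem_affine_of_mem_filt_one (h : IsSkewPBW R x) {f : A} (hf : f ∈ h.filt 1) :
    f ∈ affine R x := by
  rw [h.sum_coeff f]
  refine Submodule.sum_mem _ fun t ht => Submodule.smul_mem _ _ ?_
  have hd : ∑ i, t i ≤ 1 :=
    (Finset.le_sup (f := fun t : Fin n → ℕ => ∑ i, t i) ht).trans hf
  obtain rfl | ⟨i, rfl⟩ := eq_zero_or_eq_single hd
  · rw [mon_zero]
    exact one_mem_affine
  · rw [mon_single]
    exact var_mem_affine i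

theorem var_mem_filt_one (h : IsSkewPBW R x) (i : Fin n) : x i ∈ h.filt 1 := by
  change h.deg (x i) ≤ 0 + 1
  refine Finset.sup_le fun t ht => ?_
  have ht' : h.coeffL t (x i) ≠ 0 := by
    simpa [support, coeffL_apply, coeff] using ht
  rw [← mon_single (x := x) i, coeffL_mon] at ht'
  have : Pi.single i 1 = t := by
    by_contra hc
    simp [hc] at ht'
  subst this
  simp

/-- An element of the span of `1, x₁, …, xₙ` in terms of its coefficients. -/
theorem affine_eq_sum (h : IsSkewPBW R x) {f : A} (hf : f ∈ affine R x) :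
    f = ∑ k, h.coeff f (Pi.single k 1) • x k + h.coeff f 0 • (1 : A) := by
  -- Both sides are R-linear in `f`, so the identity need only be checked on 1 and the variables.
  have key : affine R x ≤ LinearMap.eqLocus LinearMap.id
      (∑ k, (h.coeffL (Pi.single k 1)).smulRight (x k) + (h.coeffL 0).smulRight (1 : A)) := by
    refine affine_le ?_ fun i => ?_
    · have : ∀ k : Fin n, (0 : Fin n → ℕ) ≠ Pi.single k 1 := fun k e => by
        simpa using congrFun e k
      have h1 : ∀ t, h.coeffL t 1 = if 0 = t then 1 else 0 := fun t => by
        rw [← mon_zero (x := x), coeffL_mon]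
      simp [LinearMap.mem_eqLocus, h1, this]
    · have h0 : (Pi.single i 1 : Fin n → ℕ) ≠ 0 := fun e => by simpa using congrFun e i
      have h1 : ∀ t, h.coeffL t (x i) = if Pi.single i 1 = t then 1 else 0 := fun t => by
        rw [← mon_single (x := x), coeffL_mon]
      have h2 : ∀ k : Fin n,
          ((Pi.single i 1 : Fin n → ℕ) = Pi.single k 1) ↔ i = k := fun k =>
        ⟨fun e => by
          by_contra hc
          simpa [hc] using congrFun e i, fun e => by rw [e]⟩
      simp [LinearMap.mem_eqLocus, h1, h0, h2, ite_smul]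
  have := key hf
  simpa [LinearMap.mem_eqLocus, coeffL_apply] using this

/-- The terms of degree two of a product of two elements of degree at most one. -/
theorem coeffL_mul (h : IsSkewPBW R x) {f g : A} (hf : f ∈ affine R x) (hg : g ∈ affine R x)
    (k l : Fin n) :
    h.coeffL (Pi.single k 1 + Pi.single l 1) (f * g) =
      ∑ p, ∑ q, h.coeff f (Pi.single p 1) * h.sigma p (h.coeff g (Pi.single q 1)) *
        h.coeffL (Pi.single k 1 + Pi.single l 1) (x p * x q) := by
  have hx : ∀ p, h.coeffL (Pi.single k 1 + Pi.single l 1) (x p * g) =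
      ∑ q, h.sigma p (h.coeff g (Pi.single q 1)) *
        h.coeffL (Pi.single k 1 + Pi.single l 1) (x p * x q) := by
    intro p
    -- Moving `r` past x_p costs σ_p and an extra term `d • y`, which is affine and so invisible
    -- here.
    have hq : ∀ (r : R) (y : A), y ∈ affine R x →
        h.coeffL (Pi.single k 1 + Pi.single l 1) (x p * (r • y)) =
          h.sigma p r * h.coeffL (Pi.single k 1 + Pi.single l 1) (x p * y) := by
      intro r y hy
      obtain ⟨d, hd⟩ := h.mul_smul_eq p r
      rw [hd, map_add, map_smul, map_smul, h.coeffL_affine hy]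
      simp
    conv_lhs => rw [h.affine_eq_sum hg]
    rw [mul_add, map_add, hq _ _ one_mem_affine, mul_one, h.coeffL_affine (var_mem_affine p),
      mul_zero, add_zero, Finset.mul_sum, map_sum]
    exact Finset.sum_congr rfl fun q _ => hq _ _ (var_mem_affine q)
  conv_lhs => rw [h.affine_eq_sum hf]
  rw [add_mul, map_add, smul_mul_assoc, one_mul, map_smul, h.coeffL_affine hg, smul_zero, add_zero,
    Finset.sum_mul, map_sum]
  refine Finset.sum_congr rfl fun p _ => ?_
  rw [smul_mul_assoc, map_smul, hx, smul_eq_mul, Finset.mul_sum]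
  simp only [mul_assoc]

theorem coeffL_var_mul_var_of_le (h : IsSkewPBW R x) {k l p q : Fin n} (hpq : p ≤ q) :
    h.coeffL (Pi.single k 1 + Pi.single l 1) (x p * x q) =
      if (Pi.single p 1 + Pi.single q 1 : Fin n → ℕ) = Pi.single k 1 + Pi.single l 1
      then 1 else 0 := by
  rw [← mon_single_add_single x hpq, coeffL_mon]

/-- A product in the wrong order is, modulo `affine`, a multiple of the ordered monomial in the same
two variables. -/
theorem coeffL_var_mul_var_eq_zero (h : IsSkewPBW R x) {k l p q : Fin n}
    (h1 : ¬(p = k ∧ q = l)) (h2 : ¬(p = l ∧ q = k)) :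
    h.coeffL (Pi.single k 1 + Pi.single l 1) (x p * x q) = 0 := by
  have key : ∀ {a b : Fin n}, a ≤ b → ¬(a = k ∧ b = l) → ¬(a = l ∧ b = k) →
      h.coeffL (Pi.single k 1 + Pi.single l 1) (x a * x b) = 0 := by
    intro a b hab h1 h2
    rw [h.coeffL_var_mul_var_of_le hab, if_neg]
    intro e
    rcases single_add_single_eq e with e | e
    exacts [h1 e, h2 e]
  rcases le_total p q with hpq | hqp
  · exact key hpq h1 h2
  · obtain ⟨c, -, hc⟩ := h.comm_var q p
    have := h.coeffL_affine hc k l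
    rw [map_sub, sub_eq_zero] at this
    rw [this, ← smul_eq_mul (c : A), ← Subring.smul_def, map_smul, key hqp (by tauto) (by tauto),
      smul_zero]

/-- If the terms of degree one of `g` do not involve `x k`, then the only contribution to the
coefficient of `x k * x l` in `f * g` comes from the product of `x k` and `x l`. -/
theorem coeffL_mul_left (h : IsSkewPBW R x) {f g : A} (hf : f ∈ affine R x)
    (hg : g ∈ affine R x) {k l : Fin n} (hkl : k ≤ l)
    (h0 : k ≠ l → h.coeff g (Pi.single k 1) = 0) :
    h.coeffL (Pi.single k 1 + Pi.single l 1) (f * g) =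
      h.coeff f (Pi.single k 1) * h.sigma k (h.coeff g (Pi.single l 1)) := by
  rw [h.coeffL_mul hf hg, Finset.sum_eq_single k, Finset.sum_eq_single l,
    h.coeffL_var_mul_var_of_le hkl, if_pos rfl, mul_one]
  · intro q _ hq
    rw [h.coeffL_var_mul_var_eq_zero (fun e => hq e.2) (fun e => hq (e.2.trans e.1)), mul_zero]
  · simp
  · intro p _ hp
    refine Finset.sum_eq_zero fun q _ => ?_
    -- The reversed product x_l x_k could also contribute; `h0` removes it. When k = l it is the
    -- same product, so nothing need be assumed.
    by_cases hpq : p = l ∧ q = k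
    · rw [hpq.2, h0 (fun e => hp (hpq.1.trans e.symm)), map_zero, mul_zero, zero_mul]
    · rw [h.coeffL_var_mul_var_eq_zero (fun e => hp e.1) hpq, mul_zero]
  · simp

/-- If the terms of degree one of `f` do not involve `x k`, then the only contribution to the
coefficient of `x k * x l` in `f * g` comes from the product of `x l` and `x k`. -/
theorem coeffL_mul_right (h : IsSkewPBW R x) {f g : A} (hf : f ∈ affine R x)
    (hg : g ∈ affine R x) {k l : Fin n}
    (h0 : k ≠ l → h.coeff f (Pi.single k 1) = 0) :
    h.coeffL (Pi.single k 1 + Pi.single l 1) (f * g) =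
      h.coeff f (Pi.single l 1) * h.sigma l (h.coeff g (Pi.single k 1)) *
        h.coeffL (Pi.single k 1 + Pi.single l 1) (x l * x k) := by
  rw [h.coeffL_mul hf hg, Finset.sum_eq_single l, Finset.sum_eq_single k]
  · intro q _ hq
    rw [h.coeffL_var_mul_var_eq_zero (fun e => hq (e.2.trans e.1)) (fun e => hq e.2), mul_zero]
  · simp
  · intro p _ hp
    refine Finset.sum_eq_zero fun q _ => ?_
    by_cases hpq : p = k ∧ q = l
    · rw [hpq.1, h0 (fun e => hp (hpq.1.trans e)), zero_mul, zero_mul]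
    · rw [h.coeffL_var_mul_var_eq_zero hpq (fun e => hp e.1), mul_zero]
  · simp

/-! ### A filtration by weights -/

/-- The weight of the `i`-th variable: decreasing in `i`, and every weight is smaller than the sum
of any two weights. -/
def varWeight (i : Fin n) : ℕ := 2 * n - i

/-- The weight of the monomial with exponent `t`. -/
def weight (t : Fin n → ℕ) : ℕ := ∑ i, t i * varWeight i

theorem varWeight_pos (i : Fin n) : 0 < varWeight i := by
  have := i.2
  unfold varWeight
  omega

theorem varWeight_lt {i j : Fin n} (hij : i < j) : varWeight j < varWeight i := by
  have := j.2
  have : (i : ℕ) < j := hij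
  unfold varWeight
  omega

theorem varWeight_lt_add (i j k : Fin n) : varWeight k < varWeight i + varWeight j := by
  have := i.2
  have := j.2
  unfold varWeight
  omega

theorem weight_add_single (t : Fin n → ℕ) (i : Fin n) :
    weight (t + Pi.single i 1) = weight t + varWeight i := by
  simp [weight, add_mul, Finset.sum_add_distrib, Pi.single_apply]

variable (R x) in
/-- The `R`-span of the monomials of weight less than `m`. -/
def lowWeight (m : ℕ) : Submodule R A := Submodule.span R (mon x '' {t | weight t < m})

theorem lowWeight_mono {m k : ℕ} (hmk : m ≤ k) : lowWeight R x m ≤ lowWeight R x k :=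
  Submodule.span_mono (Set.image_mono fun _ ht => lt_of_lt_of_le ht hmk)

theorem mon_mem_lowWeight {t : Fin n → ℕ} {m : ℕ} (ht : weight t < m) :
    mon x t ∈ lowWeight R x m :=
  Submodule.subset_span ⟨t, ht, rfl⟩

/-- The hypothesis is bounded by `m` so that the lemma can be used inside the induction on weight
that proves it. -/
theorem var_mul_mem_lowWeight_aux (h : IsSkewPBW R x) {i : Fin n} {m : ℕ}
    (hi : ∀ t, weight t < m → x i * mon x t ∈ lowWeight R x (weight t + varWeight i + 1))
    {f : A} (hf : f ∈ lowWeight R x m) : x i * f ∈ lowWeight R x (m + varWeight i) := by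
  induction hf using Submodule.span_induction with
  | mem f hf =>
    obtain ⟨t, ht, rfl⟩ := hf
    have ht' : weight t < m := ht
    exact lowWeight_mono (by omega) (hi t ht')
  | zero => simp
  | add f g _ _ hf hg =>
    rw [mul_add]
    exact add_mem hf hg
  | smul r f hf' hf =>
    obtain ⟨d, hd⟩ := h.mul_smul_eq i r
    rw [hd]
    exact add_mem (Submodule.smul_mem _ _ hf)
      (Submodule.smul_mem _ _ (lowWeight_mono (by omega) hf'))

/-- If x_i is not already in place, it is exchanged with the first variable x_j of the monomial,
where j < i, and one inducts on weight. -/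
theorem var_mul_mon_mem_lowWeight (h : IsSkewPBW R x) (i : Fin n) (t : Fin n → ℕ) :
    x i * mon x t ∈ lowWeight R x (weight t + varWeight i + 1) := by
  induction hN : weight t using Nat.strong_induction_on generalizing i t with
  | _ N ih =>
    subst hN
    by_cases ht : ∀ j < i, t j = 0
    · rw [mul_mon_of_forall_lt x i t ht]
      exact mon_mem_lowWeight (by rw [weight_add_single]; omega)
    have ht0 : t ≠ 0 := fun e => ht fun j _ => congrFun e j
    obtain ⟨j, s, rfl, hs⟩ := exists_eq_add_single ht0
    have hji : j < i := by
      by_contra hij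
      refine ht fun k hk => ?_
      have hkj : k < j := lt_of_lt_of_le hk (not_lt.mp hij)
      simp [hs k hkj, hkj.ne]
    have hwj := varWeight_pos j
    have hw := varWeight_lt hji
    rw [← mul_mon_of_forall_lt x j s hs]
    rw [weight_add_single] at ih ⊢
    obtain ⟨c, -, hc⟩ := h.comm_var j i
    have e : x i * (x j * mon x s) = c • (x j * (x i * mon x s)) +
        (x i * x j - (c : A) * (x j * x i)) * mon x s := by
      rw [Subring.smul_def, smul_eq_mul]
      noncomm_ring
    rw [e]
    refine add_mem (Submodule.smul_mem _ _ ?_) ?_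
    -- The monomials of x_i x^s weigh at most `weight s + varWeight i`. As j < i, this is less than
    -- the weight of x_j x^s, so the induction hypothesis applies to them.
    · have h1 := ih (weight s) (by omega) i s rfl
      have h2 := h.var_mul_mem_lowWeight_aux (i := j) (m := weight s + varWeight i + 1)
        (fun t' ht' => ih (weight t') (by omega) j t' rfl) h1
      exact lowWeight_mono (by omega) h2
    -- The affine error is harmless because one variable weighs less than any two.
    · have hlin : affine R x ≤ (lowWeight R x (weight s + varWeight j + varWeight i + 1)).comap
          (LinearMap.mulRight R (mon x s)) := by
        refine affine_le ?_ fun k => ?_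
        · simp only [Submodule.mem_comap, LinearMap.mulRight_apply, one_mul]
          exact mon_mem_lowWeight (by omega)
        · simp only [Submodule.mem_comap, LinearMap.mulRight_apply]
          have := varWeight_lt_add j i k
          exact lowWeight_mono (by omega) (ih (weight s) (by omega) k s rfl)
      exact hlin hc

theorem var_mul_mem_lowWeight (h : IsSkewPBW R x) (i : Fin n) {m : ℕ} {f : A}
    (hf : f ∈ lowWeight R x m) : x i * f ∈ lowWeight R x (m + varWeight i) :=
  h.var_mul_mem_lowWeight_aux (fun t _ => h.var_mul_mon_mem_lowWeight i t) hf

/-! ### Triangular endomorphisms -/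

/-- An element of `End(A)` as an `R`-linear map. -/
def toLinear (lam : relEnd R) : A →ₗ[R] A where
  toFun := lam.1
  map_add' := map_add lam.1
  map_smul' r f := by
    simp only [Subring.smul_def, smul_eq_mul, map_mul, RingHom.id_apply]
    rw [lam.2 r r.2]

theorem map_smul_relEnd (lam : relEnd R) (r : R) (f : A) : lam.1 (r • f) = r • lam.1 f :=
  map_smul (toLinear lam) r f

/-- An endomorphism which is triangular on the variables, with units on the diagonal, is triangular
on the monomials, with units on the diagonal. -/
theorem map_mon_of_triangular (h : IsSkewPBW R x) (lam : relEnd R)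
    (haff : ∀ i, lam.1 (x i) ∈ affine R x)
    (hunit : ∀ i, IsUnit (h.coeff (lam.1 (x i)) (Pi.single i 1)))
    (hlow : ∀ i, ∀ k < i, h.coeff (lam.1 (x i)) (Pi.single k 1) = 0) (t : Fin n → ℕ) :
    ∃ u : Rˣ, lam.1 (mon x t) - (u : R) • mon x t ∈ lowWeight R x (weight t) := by
  induction hN : weight t using Nat.strong_induction_on generalizing t with
  | _ N ih =>
    subst hN
    by_cases ht0 : t = 0
    · subst ht0
      exact ⟨1, by simp [mon_zero]⟩
    obtain ⟨j, s, rfl, hs⟩ := exists_eq_add_single ht0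
    have hwj := varWeight_pos j
    rw [weight_add_single] at ih ⊢
    obtain ⟨u, hu⟩ := ih (weight s) (by omega) s rfl
    obtain ⟨a, ha⟩ := hunit j
    set g := lam.1 (mon x s) with hg
    have hgmem : g ∈ lowWeight R x (weight s + 1) := by
      rw [← sub_add_cancel g ((u : R) • mon x s)]
      exact add_mem (lowWeight_mono (by omega) hu)
        (Submodule.smul_mem _ _ (mon_mem_lowWeight (by omega)))
    -- The unit `u` of x^s passes to the left of x_j, which turns it into σ_j(u).
    refine ⟨a * Units.map (h.sigma j : R →* R) u, ?_⟩
    obtain ⟨d, hd⟩ := h.mul_smul_eq j (u : R)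
    have hxg : x j * g - h.sigma j u • mon x (s + Pi.single j 1)
        ∈ lowWeight R x (weight s + varWeight j) := by
      have e : x j * g - h.sigma j u • mon x (s + Pi.single j 1)
          = x j * (g - (u : R) • mon x s) + d • mon x s := by
        rw [mul_sub, hd, mul_mon_of_forall_lt x j s hs]
        abel
      rw [e]
      exact add_mem (h.var_mul_mem_lowWeight j hu)
        (Submodule.smul_mem _ _ (mon_mem_lowWeight (by omega)))
    have hsplit : lam.1 (x j) * g - (a : R) • (x j * g)
        ∈ lowWeight R x (weight s + varWeight j) := by
      conv in lam.1 (x j) => rw [h.affine_eq_sum (haff j)]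
      rw [← Finset.add_sum_erase _ _ (Finset.mem_univ j), ← ha, add_assoc, add_mul,
        smul_mul_assoc, add_sub_cancel_left, add_mul, smul_mul_assoc, one_mul, Finset.sum_mul]
      refine add_mem (Submodule.sum_mem _ fun k hk => ?_)
        (Submodule.smul_mem _ _ (lowWeight_mono (by omega) hgmem))
      rw [smul_mul_assoc]
      -- Earlier variables are absent by `hlow`; later ones weigh strictly less than x_j.
      rcases lt_trichotomy k j with hkj | rfl | hjk
      · rw [hlow j k hkj, zero_smul]
        exact zero_mem _
      · simp at hk
      · have := varWeight_lt hjk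
        exact Submodule.smul_mem _ _
          (lowWeight_mono (by omega) (h.var_mul_mem_lowWeight k hgmem))
    have e : lam.1 (mon x (s + Pi.single j 1))
          - ((a * Units.map (h.sigma j : R →* R) u : Rˣ) : R) • mon x (s + Pi.single j 1)
        = (lam.1 (x j) * g - (a : R) • (x j * g))
          + (a : R) • (x j * g - h.sigma j u • mon x (s + Pi.single j 1)) := by
      rw [← mul_mon_of_forall_lt x j s hs, map_mul, smul_sub, smul_smul]
      simp [hg]
    rw [e]
    exact add_mem hsplit (Submodule.smul_mem _ _ hxg)

/-- A monomial of maximal weight in f survives in lam(f) with its coefficient multiplied by a unit,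
which gives injectivity. Surjectivity follows by solving for x^t, inductively on weight. -/
theorem bijective_of_map_mon (h : IsSkewPBW R x) (lam : relEnd R)
    (hmon : ∀ t, ∃ u : Rˣ, lam.1 (mon x t) - (u : R) • mon x t ∈ lowWeight R x (weight t)) :
    Function.Bijective lam.1 := by
  constructor
  · rw [injective_iff_map_eq_zero]
    intro f hf
    by_contra hf0
    have hne : (h.support f).Nonempty := by
      rw [support, Finsupp.support_nonempty_iff]
      simpa using hf0
    obtain ⟨t, ht, hmax⟩ := (h.support f).exists_max_image weight hne
    have hterm : ∀ s ∈ h.support f, s ≠ t → h.coeffL t (lam.1 (mon x s)) = 0 := by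
      intro s hs hst
      obtain ⟨u, hu⟩ := hmon s
      have h1 := h.coeffL_eq_zero_of_mem_span (S := {t | weight t < weight s}) hu (t := t)
        (not_lt.mpr (hmax s hs))
      rw [map_sub, map_smul, coeffL_mon, if_neg hst, smul_zero, sub_zero] at h1
      exact h1
    obtain ⟨u, hu⟩ := hmon t
    have h1 := h.coeffL_eq_zero_of_mem_span (S := {s | weight s < weight t}) hu (t := t)
      (lt_irrefl (weight t))
    rw [map_sub, map_smul, coeffL_mon, if_pos rfl, smul_eq_mul, mul_one, sub_eq_zero] at h1
    have h2 : h.coeffL t (lam.1 f) = h.coeff f t * u := by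
      conv_lhs => rw [h.sum_coeff f]
      simp only [map_sum, map_smul_relEnd, map_smul]
      rw [Finset.sum_eq_single t (fun s hs hst => by rw [hterm s hs hst, smul_zero])
        (fun hc => absurd ht hc), h1, smul_eq_mul]
    rw [hf, map_zero, eq_comm, Units.mul_left_eq_zero] at h2
    exact (Finsupp.mem_support_iff.mp ht) h2
  · have key : ∀ t, mon x t ∈ LinearMap.range (toLinear lam) := by
      intro t
      induction hN : weight t using Nat.strong_induction_on generalizing t with
      | _ N ih =>
        subst hN
        obtain ⟨u, hu⟩ := hmon t
        have hle : lowWeight R x (weight t) ≤ LinearMap.range (toLinear lam) := by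
          rw [lowWeight, Submodule.span_le]
          rintro _ ⟨s, hs, rfl⟩
          exact ih _ hs s rfl
        have h1 : (u : R) • mon x t ∈ LinearMap.range (toLinear lam) := by
          have := sub_mem (LinearMap.mem_range_self (toLinear lam) (mon x t)) (hle hu)
          simpa [toLinear] using this
        have := Submodule.smul_mem _ ((u⁻¹ : Rˣ) : R) h1
        rwa [smul_smul, Units.inv_mul, one_smul] at this
    have htop : LinearMap.range (toLinear lam) = ⊤ := by
      rw [eq_top_iff, ← h.span_eq_top, Submodule.span_le]
      rintro _ ⟨t, rfl⟩
      exact key t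
    exact LinearMap.range_eq_top.mp htop

/-- A bijective element of `End(A)` lies in `Aut(A)`. -/
theorem isUnit_of_bijective (lam : relEnd R) (hb : Function.Bijective lam.1) : IsUnit lam := by
  let e : A ≃+* A := RingEquiv.ofBijective lam.1 hb
  have he : ∀ a, e a = lam.1 a := fun _ => rfl
  let inv : relEnd R := ⟨(e.symm : A →+* A), fun r hr => by
    change e.symm r = r
    rw [RingEquiv.symm_apply_eq, he, lam.2 r hr]⟩
  refine ⟨⟨lam, inv, ?_, ?_⟩, rfl⟩
  · ext a
    exact e.apply_symm_apply a
  · ext a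
    exact e.symm_apply_apply a

/-! ### Leading variables, and the quotient by N -/

/-- An element of degree one with invertible lexicographic leading coefficient. -/
theorem exists_lead (h : IsSkewPBW R x) {f : A} (hf : f ∈ h.filt 1) (hf0 : f ∉ h.filt 0)
    (hu : IsUnit (h.leadCoeff f)) :
    ∃ k, IsUnit (h.coeff f (Pi.single k 1)) ∧ ∀ p < k, h.coeff f (Pi.single p 1) = 0 := by
  have hdeg : ∀ t ∈ h.support f, t = 0 ∨ ∃ i, t = Pi.single i 1 := fun t ht =>
    eq_zero_or_eq_single ((Finset.le_sup (f := fun t : Fin n → ℕ => ∑ i, t i) ht).trans hf)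
  obtain ⟨t, ht, ht0⟩ : ∃ t ∈ h.support f, t ≠ 0 := by
    by_contra! hc
    apply hf0
    rw [h.sum_coeff f]
    refine Subring.sum_mem R fun t ht => ?_
    rw [hc t ht, mon_zero, Subring.smul_def, smul_eq_mul, mul_one]
    exact (h.coeff f 0).2
  have hne : ((h.support f).image toLex).Nonempty := ⟨_, Finset.mem_image_of_mem _ ht⟩
  rw [leadCoeff, dif_pos hne] at hu
  set M := ((h.support f).image toLex).max' hne with hM
  have hMmem : ofLex M ∈ h.support f := by
    obtain ⟨s, hs, e⟩ := Finset.mem_image.mp (Finset.max'_mem _ hne)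
    rw [← hM] at e
    rw [← e]
    exact hs
  have hmax : ∀ s ∈ h.support f, toLex s ≤ M := fun s hs =>
    Finset.le_max' _ _ (Finset.mem_image_of_mem _ hs)
  -- Earlier variables are lexicographically larger, so the leading variable is the one of least
  -- index.
  have hlt : ∀ (p : Fin n) (s : Fin n → ℕ), (∀ j ≤ p, s j = 0) →
      toLex s < toLex (Pi.single p 1 : Fin n → ℕ) := by
    intro p s hs
    refine ⟨p, fun j hj => ?_, ?_⟩
    · simp [hs j hj.le, hj.ne]
    · simp [hs p le_rfl]
  obtain ⟨i, rfl⟩ := (hdeg t ht).resolve_left ht0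
  obtain h0 | ⟨k, hk⟩ := hdeg _ hMmem
  · have := hlt i (ofLex M) (fun j _ => by rw [h0]; rfl)
    exact absurd (hmax _ ht) (not_le.mpr this)
  · refine ⟨k, hk ▸ hu, fun p hp => ?_⟩
    by_contra hc
    have hmem : (Pi.single p 1 : Fin n → ℕ) ∈ h.support f := Finsupp.mem_support_iff.mpr hc
    have := hlt p (ofLex M) (fun j hj => by
      rw [hk]
      exact Pi.single_eq_of_ne (hj.trans_lt hp).ne _)
    exact absurd (hmax _ hmem) (not_le.mpr this)

/-- This is what the generators z⁻¹σ_i(z) of N are for. -/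
theorem mk_map_sigma (h : IsSkewPBW R x) (i : Fin n) (z : Rˣ) :
    (QuotientGroup.mk (Units.map (h.sigma i : R →* R) z) : Rˣ ⧸ h.N) = QuotientGroup.mk z := by
  refine (QuotientGroup.eq.mpr ?_).symm
  exact Subgroup.mem_sup_right (Subgroup.subset_closure ⟨i, z, rfl⟩)

end IsSkewPBW

/-! ### Rigidity of independent antisymmetric families -/

/-- An antisymmetric family whose part above the diagonal is independent is injective off the
diagonal. -/
theorem eq_of_independent {G : Type*} [CommGroup G] {n : ℕ} {g : Fin n → Fin n → G}
    (hg : LinearIndependent ℤ (fun p : {p : Fin n × Fin n // p.1 < p.2} =>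
      Additive.ofMul (g p.1.1 p.1.2)))
    (hinv : ∀ i j, i ≠ j → g i j * g j i = 1) {i j k l : Fin n} (hij : i ≠ j) (hkl : k ≠ l)
    (e : g i j = g k l) : i = k ∧ j = l := by
  have hne : ∀ {i j k l : Fin n}, i < j → l < k → g i j ≠ g k l := by
    intro i j k l hij hlk e
    let p : {p : Fin n × Fin n // p.1 < p.2} := ⟨(i, j), hij⟩
    let q : {p : Fin n × Fin n // p.1 < p.2} := ⟨(l, k), hlk⟩
    -- From g i j = g k l = (g l k)⁻¹ comes a relation whose coefficient at `p` is 1, or 2 if p = q;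
    -- it is nonzero either way.
    have h0 : Finsupp.linearCombination ℤ
        (fun p : {p : Fin n × Fin n // p.1 < p.2} => Additive.ofMul (g p.1.1 p.1.2))
        (Finsupp.single p 1 + Finsupp.single q 1) = 0 := by
      simp only [map_add, Finsupp.linearCombination_single, one_smul, p, q]
      rw [← ofMul_mul, e, hinv k l hlk.ne', ofMul_one]
    have h1 := DFunLike.congr_fun (linearIndependent_iff.mp hg _ h0) p
    simp only [Finsupp.add_apply, Finsupp.single_apply, Finsupp.zero_apply] at h1
    split_ifs at h1 <;> omega
  have heq : ∀ {i j k l : Fin n}, i < j → k < l → g i j = g k l → i = k ∧ j = l := by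
    intro i j k l hij hkl e
    have := hg.injective (a₁ := ⟨(i, j), hij⟩) (a₂ := ⟨(k, l), hkl⟩) (by simpa using e)
    simpa using this
  rcases lt_or_gt_of_ne hij with h1 | h1 <;> rcases lt_or_gt_of_ne hkl with h2 | h2
  · exact heq h1 h2 e
  · exact absurd e (hne h1 h2)
  · exact absurd e.symm (hne h2 h1)
  · have e' : g j i = g l k := by
      have := hinv i j hij
      rw [e, ← hinv k l hkl] at this
      exact mul_left_cancel this
    exact (heq h1 h2 e').symm

/-! ### Commutation relations between leading terms -/

namespace IsSkewPBW

variable {R : Subring A} {n : ℕ} {x : Fin n → A}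

theorem coeffL_eq_of_sub_mem (h : IsSkewPBW R x) {f g : A} {c : R}
    (hfg : f - (c : A) * g ∈ affine R x) (k l : Fin n) :
    h.coeffL (Pi.single k 1 + Pi.single l 1) f =
      c * h.coeffL (Pi.single k 1 + Pi.single l 1) g := by
  have := h.coeffL_affine hfg k l
  rwa [map_sub, sub_eq_zero, ← smul_eq_mul (c : A), ← Subring.smul_def, map_smul,
    smul_eq_mul] at this

theorem map_mem_affine (lam : relEnd R) (haff : ∀ i, lam.1 (x i) ∈ affine R x) {f : A}
    (hf : f ∈ affine R x) : lam.1 f ∈ affine R x := by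
  have : affine R x ≤ (affine R x).comap (toLinear lam) := by
    refine affine_le ?_ haff
    change lam.1 1 ∈ affine R x
    rw [map_one]
    exact one_mem_affine
  exact this hf

/-- The degree-two relations pass to invertible leading coefficients. -/
theorem commute_lead_same (h : IsSkewPBW R x) {f g : A} (hf : f ∈ affine R x)
    (hg : g ∈ affine R x) {c a b : Rˣ} {k : Fin n}
    (hfg : f * g - ((c : R) : A) * (g * f) ∈ affine R x)
    (ha : h.coeff f (Pi.single k 1) = a) (hb : h.coeff g (Pi.single k 1) = b) :
    a * Units.map (h.sigma k : R →* R) b = c * (b * Units.map (h.sigma k : R →* R) a) := by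
  have h1 := h.coeffL_eq_of_sub_mem hfg k k
  rw [h.coeffL_mul_left hf hg le_rfl (fun e => absurd rfl e),
    h.coeffL_mul_left hg hf le_rfl (fun e => absurd rfl e), ha, hb] at h1
  exact Units.ext h1

/-- Since g has no x_k term, x_k x_l arises in f g only from x_k · x_l, and in g f only from x_l ·
x_k, whose reordering produces the factor `d`. -/
theorem commute_lead_lt (h : IsSkewPBW R x) {f g : A} (hf : f ∈ affine R x)
    (hg : g ∈ affine R x) {c d a b : Rˣ} {k l : Fin n} (hkl : k < l)
    (hfg : f * g - ((c : R) : A) * (g * f) ∈ affine R x)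
    (hd : x l * x k - ((d : R) : A) * (x k * x l) ∈ affine R x)
    (ha : h.coeff f (Pi.single k 1) = a) (hb : h.coeff g (Pi.single l 1) = b)
    (h0 : h.coeff g (Pi.single k 1) = 0) :
    a * Units.map (h.sigma k : R →* R) b
      = c * (b * Units.map (h.sigma l : R →* R) a * d) := by
  have h1 := h.coeffL_eq_of_sub_mem hfg k l
  rw [h.coeffL_mul_left hf hg hkl.le (fun _ => h0), h.coeffL_mul_right hg hf (fun _ => h0),
    h.coeffL_eq_of_sub_mem hd, h.coeffL_var_mul_var_of_le hkl.le, if_pos rfl, mul_one, ha,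
    hb] at h1
  exact Units.ext h1

theorem mul_eq_one_of_comm (h : IsSkewPBW R x) {c d : Rˣ} {k l : Fin n} (hkl : k < l)
    (hc : x k * x l - ((c : R) : A) * (x l * x k) ∈ affine R x)
    (hd : x l * x k - ((d : R) : A) * (x k * x l) ∈ affine R x) : c * d = 1 := by
  have h1 := h.coeffL_eq_of_sub_mem hc k l
  rw [h.coeffL_eq_of_sub_mem hd, h.coeffL_var_mul_var_of_le hkl.le, if_pos rfl, mul_one] at h1
  exact Units.ext h1.symm

/-- If the commutation coefficients are independent in an abelian quotient of `Rˣ` on which the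
`σ_i` act trivially, an endomorphism of degree one with invertible leading coefficients is
triangular. -/
theorem lead_eq_self (h : IsSkewPBW R x) {G : Type*} [CommGroup G] (φ : Rˣ →* G)
    (hφ : ∀ i z, φ (Units.map (h.sigma i : R →* R) z) = φ z) (c : Fin n → Fin n → Rˣ)
    (hc : ∀ i j, x i * x j - ((c i j : R) : A) * (x j * x i) ∈ affine R x)
    (hind : LinearIndependent ℤ (fun p : {p : Fin n × Fin n // p.1 < p.2} =>
      Additive.ofMul (φ (c p.1.1 p.1.2))))
    (hn : ∀ i : Fin n, ∃ j, j ≠ i)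
    (lam : relEnd R) (haff : ∀ i, lam.1 (x i) ∈ affine R x) (π : Fin n → Fin n)
    (hunit : ∀ i, IsUnit (h.coeff (lam.1 (x i)) (Pi.single (π i) 1)))
    (hlow : ∀ i, ∀ k < π i, h.coeff (lam.1 (x i)) (Pi.single k 1) = 0) (i : Fin n) :
    π i = i := by
  choose a ha using hunit
  have hinv : ∀ k l, k ≠ l → φ (c k l) * φ (c l k) = 1 := by
    have key : ∀ k l, k < l → φ (c k l) * φ (c l k) = 1 := fun k l hkl => by
      rw [← map_mul, h.mul_eq_one_of_comm hkl (hc k l) (hc l k), map_one]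
    intro k l hkl
    rcases lt_or_gt_of_ne hkl with hlt | hlt
    · exact key k l hlt
    · rw [mul_comm]
      exact key l k hlt
  have hlam : ∀ i j, lam.1 (x i) * lam.1 (x j) -
      ((c i j : R) : A) * (lam.1 (x j) * lam.1 (x i)) ∈ affine R x := by
    intro i j
    have := map_mem_affine lam haff (hc i j)
    rwa [map_sub, map_mul, map_mul, map_mul, lam.2 _ (c i j : R).2] at this
  -- If the leading variables agree, the unit factors cancel in G and leave φ(c i j) = 1, which no
  -- member of an independent family satisfies.
  have hinj : ∀ i j, i ≠ j → π i ≠ π j := by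
    have key : ∀ i j, i < j → π i ≠ π j := by
      intro i j hij hπ
      have h1 := congrArg φ (h.commute_lead_same (haff i) (haff j) (hlam i j) (ha i).symm
        (k := π i) (b := a j) (by rw [hπ, ha]))
      rw [map_mul, map_mul, map_mul, hφ, hφ, mul_comm (φ (a i))] at h1
      exact hind.ne_zero ⟨(i, j), hij⟩ (congrArg Additive.ofMul (right_eq_mul.mp h1))
    intro i j hij
    rcases lt_or_gt_of_ne hij with hlt | hlt
    · exact key i j hlt
    · exact (key j i hlt).symm
  have hperm : ∀ i j, i ≠ j → φ (c i j) = φ (c (π i) (π j)) := by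
    have key : ∀ i j, π i < π j → φ (c i j) = φ (c (π i) (π j)) := by
      intro i j hπ
      -- After cancellation this says φ(c i j) φ(c (π j) (π i)) = 1; antisymmetry inverts the second
      -- factor.
      have h1 := congrArg φ (h.commute_lead_lt (haff i) (haff j) hπ (hlam i j) (hc _ _)
        (ha i).symm (ha j).symm (hlow j _ hπ))
      rw [map_mul, map_mul, map_mul, map_mul, hφ, hφ, mul_comm (φ (a i)), mul_left_comm] at h1
      have h2 := mul_eq_left.mp h1.symm
      rw [← hinv (π i) (π j) hπ.ne] at h2
      exact mul_right_cancel h2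
    intro i j hij
    have hπ := hinj i j hij
    rcases lt_or_gt_of_ne hπ with hlt | hlt
    · exact key i j hlt
    · have h1 := hinv i j hij
      rw [key j i hlt, ← hinv (π i) (π j) hπ] at h1
      exact mul_right_cancel h1
  obtain ⟨j, hj⟩ := hn i
  exact (eq_of_independent (g := fun i j => φ (c i j)) hind hinv hj.symm (hinj i j hj.symm)
    (hperm i j hj.symm)).1.symm

end IsSkewPBW

end SkewPBW

/-! ### Conclusion -/

theorem mainTheorem4 {A : Type*} [Ring A] (R : Subring A) {n : ℕ} (x : Fin n → A)
    (hA : SkewPBW.IsSkewPBW R x) (hgen : hA.IsGeneral)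
    (lam : SkewPBW.relEnd R)
    (hfilt : ∀ m : ℕ, ∀ f ∈ hA.filt m, lam.1 f ∈ hA.filt m)
    (hlead : ∀ i, lam.1 (x i) ≠ 0 →
      lam.1 (x i) ∉ hA.filt 0 ∧ IsUnit (hA.leadCoeff (lam.1 (x i))))
    (hthree : ∃ i j u : Fin n, i ≠ j ∧ i ≠ u ∧ j ≠ u ∧
      lam.1 (x i) ≠ 0 ∧ lam.1 (x j) ≠ 0 ∧ lam.1 (x u) ≠ 0) :
    ((∀ i, lam.1 (x i) ≠ 0) → IsUnit lam) ∧
      (Function.Injective lam.1 → IsUnit lam) := by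
  obtain ⟨i₀, j₀, -, hij, -, -, hi₀, -, -⟩ := hthree
  have main : (∀ i, lam.1 (x i) ≠ 0) → IsUnit lam := by
    intro hne
    have hfilt1 : ∀ i, lam.1 (x i) ∈ hA.filt 1 := fun i => hfilt 1 _ (hA.var_mem_filt_one i)
    have haff := fun i => hA.mem_affine_of_mem_filt_one (hfilt1 i)
    have hex := fun i => hA.exists_lead (hfilt1 i) (hlead i (hne i)).1 (hlead i (hne i)).2
    choose π hunit hlow using hex
    have hn : ∀ i : Fin n, ∃ j, j ≠ i := by
      intro i
      by_cases h : i₀ = i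
      · exact ⟨j₀, fun e => hij (h.trans e.symm)⟩
      · exact ⟨i₀, h⟩
    obtain ⟨c, hc, hind⟩ := hgen
    have hπ := hA.lead_eq_self (QuotientGroup.mk' hA.N) hA.mk_map_sigma c hc hind hn lam haff π
      hunit hlow
    simp only [hπ] at hunit hlow
    exact SkewPBW.IsSkewPBW.isUnit_of_bijective lam
      (hA.bijective_of_map_mon lam (hA.map_mon_of_triangular lam haff hunit hlow))
  refine ⟨main, fun hinj => main fun i hi => ?_⟩
  have hxi : x i = 0 := (injective_iff_map_eq_zero lam.1).mp hinj _ hi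
  -- A basis element is nonzero only over a nontrivial ring; if 0 = 1, then lam(x_{i₀}) would
  -- vanish.
  have hRA : Nontrivial R := by
    refine ⟨⟨0, 1, fun e => hi₀ ?_⟩⟩
    have e' : (0 : A) = 1 := congrArg Subtype.val e
    rw [← mul_one (lam.1 (x i₀)), ← e', mul_zero]
  refine hA.linearIndependent.ne_zero (Pi.single i 1) ?_
  rw [SkewPBW.IsSkewPBW.mon_single, hxi]
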